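/- Let $M$ be a smooth (Hausdorff) manifold of dimension $4n+3$, $n\ge 0$, with an almost contact HN-metric 3-structure $(\varphi_\alpha,\xi_\alpha,\eta_\alpha,g)$, $\alpha\in\{1,2,3\}$. That is, $\varphi_\alpha$ are smooth endomorphism fields of the tangent bundle, $\xi_\alpha$ smooth vector fields and $\eta_\alpha$ smooth 1-forms with $$\varphi_\alpha\circ\varphi_\beta=-\delta_{\alpha\beta}I+\xi_\alpha\otimes\eta_\beta+\sum_{\gamma}\epsilon_{\alpha\beta\gamma}\varphi_\gamma,\qquad \varphi_\alpha\xi_\beta=\sum_\gamma\epsilon_{\alpha\beta\gamma}\xi_\gamma,\qquad \eta_\alpha\circ\varphi_\beta=\sum_\gamma\epsilon_{\alpha\beta\gamma}\eta_\gamma,\qquad \eta_\alpha(\xi_\beta)=\delta_{\alpha\beta}$$ for all $\alpha,\beta\in\{1,2,3\}$, where $\delta_{\alpha\beta}$ is the Kronecker delta, $\epsilon_{\alpha\beta\gamma}$ is the Levi-Civita symbol and $(\xi_\alpha\otimes\eta_\beta)(x)=\eta_\beta(x)\xi_\alpha$; and $g$ is a pseudo-Riemannian metric with $$g(\varphi_\alpha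 x,\varphi_\alpha y)=\varepsilon_\alpha\, g(x,y)+\eta_\alpha(x)\eta_\alpha(y),\qquad \alpha=1,2,3,\qquad (\varepsilon_1,\varepsilon_2,\varepsilon_3)=(1,-1,-1).$$ For smooth vector fields $x,y$ let $\{x,y\}=\nabla_xy+\nabla_yx$, where $\nabla$ is the Levi-Civita connection of $g$; equivalently, for all smooth vector fields $z$, $$g(\{x,y\},z)=x\,g(y,z)+y\,g(x,z)-z\,g(x,y)-g([y,z],x)+g([z,x],y).$$ Define the associated Nijenhuis tensors $\widehat N_1,\widehat N_2,\widehat N_3$ by $$\widehat N_\alpha(x,y)=\{\varphi_\alpha x,\varphi_\alpha y\}+\varphi_\alpha^2\{x,y\}-\varphi_\alpha\{\varphi_\alpha x,y\}-\varphi_\alpha\{x,\varphi_\alpha y\}-\varepsilon_\alpha\,(\mathfrak L_{\xi_\alpha}g)(x,y)\,\xi_\alpha ,$$ where $\mathfrak L_{\xi_\alpha}g$ is the Lie derivative of $g$ along $\xi_\alpha$. If two of the three tensors $\widehat N_1,\widehat N_2,\widehat N_3$ vanish identically on $M$, then the third one also vanishes identically on $M$. -/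

import Mathlib

open scoped Manifold ContDiff

noncomputable section

namespace HNContact

section Metric

variable {E : Type*} [NormedAddCommGroup E] [NormedSpace ℝ E]
  {M : Type*} [TopologicalSpace M] [ChartedSpace E M] [IsManifold 𝓘(ℝ, E) ∞ M]

/-- A smooth vector field on `M`. -/
def SmoothField (X : Π p : M, TangentSpace 𝓘(ℝ, E) p) : Prop :=
  ContMDiff 𝓘(ℝ, E) 𝓘(ℝ, E).tangent ∞
    (fun p ↦ (⟨p, X p⟩ : TangentBundle 𝓘(ℝ, E) M))

/-- A vector field that is differentiable at the point `p`. -/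
def DiffFieldAt (X : Π p : M, TangentSpace 𝓘(ℝ, E) p) (p : M) : Prop :=
  MDifferentiableAt 𝓘(ℝ, E) 𝓘(ℝ, E).tangent
    (fun q ↦ (⟨q, X q⟩ : TangentBundle 𝓘(ℝ, E) M)) p

/-- The derivative `x(f)` of a function `f` along a vector field `x`. -/
def dirDeriv (X : Π p : M, TangentSpace 𝓘(ℝ, E) p) (f : M → ℝ) (p : M) : ℝ :=
  mvfderiv 𝓘(ℝ, E) f p (X p)

variable (E M) in
/-- A pseudo-Riemannian metric on `M`: a smooth field of symmetric, nondegenerate bilinear forms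
on the tangent spaces. -/
structure PseudoRiemannianMetric where
  /-- the bilinear form on each tangent space -/
  form (p : M) :
    TangentSpace 𝓘(ℝ, E) p →L[ℝ] TangentSpace 𝓘(ℝ, E) p →L[ℝ] ℝ
  symm (p : M) (v w : TangentSpace 𝓘(ℝ, E) p) : form p v w = form p w v
  nondegenerate (p : M) (v : TangentSpace 𝓘(ℝ, E) p) : (∀ w, form p v w = 0) → v = 0
  contMDiff : ContMDiff 𝓘(ℝ, E) (𝓘(ℝ, E).prod 𝓘(ℝ, E →L[ℝ] E →L[ℝ] ℝ)) ∞
    (fun p ↦ Bundle.TotalSpace.mk' (E →L[ℝ] E →L[ℝ] ℝ)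
      (E := fun p : M ↦ TangentSpace 𝓘(ℝ, E) p →L[ℝ] TangentSpace 𝓘(ℝ, E) p →L[ℝ] ℝ) p (form p))

namespace PseudoRiemannianMetric

variable (g : PseudoRiemannianMetric E M)

/-- The function `g(x, y)` for vector fields `x`, `y`. -/
def pair (X Y : Π p : M, TangentSpace 𝓘(ℝ, E) p) (p : M) : ℝ := g.form p (X p) (Y p)

/-- The Lie derivative of the metric,
`(𝔏_ξ g)(x, y) = ξ g(x, y) - g([ξ, x], y) - g(x, [ξ, y])`. -/
def lieDeriv (ξ X Y : Π p : M, TangentSpace 𝓘(ℝ, E) p) (p : M) : ℝ :=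
  dirDeriv ξ (g.pair X Y) p
    - g.pair (VectorField.mlieBracket 𝓘(ℝ, E) ξ X) Y p
    - g.pair X (VectorField.mlieBracket 𝓘(ℝ, E) ξ Y) p

/-- The symmetrized Koszul expression
`x g(y, z) + y g(x, z) - z g(x, y) - g([y, z], x) + g([z, x], y)`, which equals
`g(∇_x y + ∇_y x, z)` for the Levi-Civita connection `∇` of `g`. -/
def symKoszul (X Y Z : Π p : M, TangentSpace 𝓘(ℝ, E) p) (p : M) : ℝ :=
  dirDeriv X (g.pair Y Z) p + dirDeriv Y (g.pair X Z) p - dirDeriv Z (g.pair X Y) p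
    - g.pair (VectorField.mlieBracket 𝓘(ℝ, E) Y Z) X p
    + g.pair (VectorField.mlieBracket 𝓘(ℝ, E) Z X) Y p

open Classical in
/-- The symmetric braces `{x, y} = ∇_x y + ∇_y x` of two vector fields: the vector field determined
by `g({x, y}, z) = symKoszul x y z` for all `z`. Existence and uniqueness of the value at `p`, for
`x` and `y` differentiable at `p`, are `form_braces` and `eq_braces` below, so that the default
value `0` is not used for such fields. -/
def braces (X Y : Π p : M, TangentSpace 𝓘(ℝ, E) p) (p : M) : TangentSpace 𝓘(ℝ, E) p :=
  if h : ∃ v : TangentSpace 𝓘(ℝ, E) p, ∀ Z : Π q : M, TangentSpace 𝓘(ℝ, E) q,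
      DiffFieldAt Z p → g.form p v (Z p) = g.symKoszul X Y Z p
  then h.choose else 0

section Lemmas

variable {g} {X Y Z : Π p : M, TangentSpace 𝓘(ℝ, E) p} {p : M}

lemma mdifferentiableAt_pair (hX : DiffFieldAt X p) (hY : DiffFieldAt Y p) :
    MDifferentiableAt 𝓘(ℝ, E) 𝓘(ℝ) (g.pair X Y) p := by
  have : MDifferentiableAt 𝓘(ℝ, E) (𝓘(ℝ, E).prod 𝓘(ℝ))
      (fun m ↦ Bundle.TotalSpace.mk' ℝ (E := Bundle.Trivial M ℝ) m (g.form m (X m) (Y m))) p := by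
    apply MDifferentiableAt.clm_bundle_apply₂ (F₁ := E) (F₂ := E)
    · exact g.contMDiff.mdifferentiableAt (by simp)
    · exact hX
    · exact hY
  simp only [mdifferentiableAt_totalSpace] at this
  exact this.2

lemma tensorialAt_symKoszul [FiniteDimensional ℝ E] (hX : DiffFieldAt X p)
    (hY : DiffFieldAt Y p) :
    TensorialAt 𝓘(ℝ, E) E (fun Z ↦ g.symKoszul X Y Z p) p := by
  have : CompleteSpace E := FiniteDimensional.complete ℝ E
  constructor
  · intro f Z hf hZ
    have h1 : g.pair Y (f • Z) = f * g.pair Y Z := by ext q; simp [pair]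
    have h2 : g.pair X (f • Z) = f * g.pair X Z := by ext q; simp [pair]
    have h3 := VectorField.mlieBracket_smul_right (I := 𝓘(ℝ, E)) (V := Y) hf hZ
    have h4 := VectorField.mlieBracket_smul_left (I := 𝓘(ℝ, E)) (W := X) hf hZ
    simp only [symKoszul, dirDeriv, h1, h2, mvfderiv_mul hf (mdifferentiableAt_pair hY hZ),
      mvfderiv_mul hf (mdifferentiableAt_pair hX hZ)]
    simp only [pair, h3, h4, Pi.smul_apply', map_add, map_smul, map_neg, neg_smul,
      add_apply, smul_apply, neg_apply,
      smul_eq_mul, g.symm p (Z p)]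
    ring
  · intro Z W hZ hW
    have h1 : g.pair Y (Z + W) = g.pair Y Z + g.pair Y W := by ext q; simp [pair]
    have h2 : g.pair X (Z + W) = g.pair X Z + g.pair X W := by ext q; simp [pair]
    have h3 := VectorField.mlieBracket_add_right (I := 𝓘(ℝ, E)) (V := Y) hZ hW
    have h4 := VectorField.mlieBracket_add_left (I := 𝓘(ℝ, E)) (W := X) hZ hW
    simp only [symKoszul, dirDeriv, h1, h2,
      mvfderiv_add (mdifferentiableAt_pair hY hZ) (mdifferentiableAt_pair hY hW),
      mvfderiv_add (mdifferentiableAt_pair hX hZ) (mdifferentiableAt_pair hX hW)]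
    simp only [pair, h3, h4, Pi.add_apply, map_add, add_apply]
    ring

lemma exists_braces [FiniteDimensional ℝ E] (hX : DiffFieldAt X p) (hY : DiffFieldAt Y p) :
    ∃ v : TangentSpace 𝓘(ℝ, E) p, ∀ Z : Π q : M, TangentSpace 𝓘(ℝ, E) q,
      DiffFieldAt Z p → g.form p v (Z p) = g.symKoszul X Y Z p := by
  have : FiniteDimensional ℝ (TangentSpace 𝓘(ℝ, E) p) := inferInstanceAs (FiniteDimensional ℝ E)
  let T := TensorialAt.mkHom (fun Z ↦ g.symKoszul X Y Z p) p (tensorialAt_symKoszul hX hY)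
  let L : TangentSpace 𝓘(ℝ, E) p →ₗ[ℝ] Module.Dual ℝ (TangentSpace 𝓘(ℝ, E) p) :=
    { toFun v := (g.form p v).toLinearMap
      map_add' v w := by ext u; simp
      map_smul' c v := by ext u; simp }
  have hL : Function.Injective L := by
    rw [injective_iff_map_eq_zero]
    intro v hv
    exact g.nondegenerate p v fun w ↦ LinearMap.congr_fun hv w
  obtain ⟨v, hv⟩ := (LinearMap.injective_iff_surjective_of_finrank_eq_finrank
    Subspace.dual_finrank_eq.symm).1 hL T.toLinearMap
  refine ⟨v, fun Z hZ ↦ ?_⟩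
  have h1 : g.form p v (Z p) = T (Z p) := LinearMap.congr_fun hv (Z p)
  rw [h1]
  exact TensorialAt.mkHom_apply (tensorialAt_symKoszul hX hY) hZ

/-- The defining property of the braces. -/
lemma form_braces [FiniteDimensional ℝ E] (hX : DiffFieldAt X p) (hY : DiffFieldAt Y p)
    (hZ : DiffFieldAt Z p) : g.form p (g.braces X Y p) (Z p) = g.symKoszul X Y Z p := by
  have h := exists_braces (g := g) hX hY
  rw [braces, dif_pos h]
  exact h.choose_spec Z hZ

/-- The defining property determines the braces. -/
lemma eq_braces [FiniteDimensional ℝ E] (hX : DiffFieldAt X p) (hY : DiffFieldAt Y p)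
    (v : TangentSpace 𝓘(ℝ, E) p)
    (hv : ∀ Z : Π q : M, TangentSpace 𝓘(ℝ, E) q, DiffFieldAt Z p →
      g.form p v (Z p) = g.symKoszul X Y Z p) : v = g.braces X Y p := by
  refine sub_eq_zero.1 (g.nondegenerate p _ fun w ↦ ?_)
  have hw : DiffFieldAt (FiberBundle.extend E w) p := FiberBundle.mdifferentiableAt_extend ..
  have h1 := hv _ hw
  rw [← form_braces hX hY hw] at h1
  simpa [sub_eq_zero] using h1

end Lemmas

end PseudoRiemannianMetric

end Metric

section Structure

/-- The Levi-Civita symbol, with the index values `1, 2, 3` written as `0, 1, 2`. -/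
def leviCivita : Fin 3 → Fin 3 → Fin 3 → ℝ
  | 0, 1, 2 => 1
  | 1, 2, 0 => 1
  | 2, 0, 1 => 1
  | 0, 2, 1 => -1
  | 2, 1, 0 => -1
  | 1, 0, 2 => -1
  | _, _, _ => 0

/-- The signs `(ε₁, ε₂, ε₃) = (1, -1, -1)`. -/
def hnSign : Fin 3 → ℝ := ![1, -1, -1]

variable (E : Type*) [NormedAddCommGroup E] [NormedSpace ℝ E]
  (M : Type*) [TopologicalSpace M] [ChartedSpace E M] [IsManifold 𝓘(ℝ, E) ∞ M]

/-- An almost contact 3-structure `(φ_α, ξ_α, η_α)`, `α = 1, 2, 3`, on `M`: smooth endomorphism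
fields, vector fields and 1-forms which satisfy the algebraic identities of such a structure. -/
structure AlmostContact3Structure where
  /-- the endomorphisms of the tangent bundle -/
  φ (α : Fin 3) (p : M) : TangentSpace 𝓘(ℝ, E) p →L[ℝ] TangentSpace 𝓘(ℝ, E) p
  /-- the Reeb vector fields -/
  ξ (α : Fin 3) (p : M) : TangentSpace 𝓘(ℝ, E) p
  /-- the contact 1-forms -/
  η (α : Fin 3) (p : M) : TangentSpace 𝓘(ℝ, E) p →L[ℝ] ℝ
  contMDiff_φ (α : Fin 3) : ContMDiff 𝓘(ℝ, E) (𝓘(ℝ, E).prod 𝓘(ℝ, E →L[ℝ] E)) ∞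
    (fun p ↦ Bundle.TotalSpace.mk' (E →L[ℝ] E)
      (E := fun p : M ↦ TangentSpace 𝓘(ℝ, E) p →L[ℝ] TangentSpace 𝓘(ℝ, E) p) p (φ α p))
  smooth_ξ (α : Fin 3) : SmoothField (ξ α)
  contMDiff_η (α : Fin 3) : ContMDiff 𝓘(ℝ, E) (𝓘(ℝ, E).prod 𝓘(ℝ, E →L[ℝ] ℝ)) ∞
    (fun p ↦ Bundle.TotalSpace.mk' (E →L[ℝ] ℝ)
      (E := fun p : M ↦ TangentSpace 𝓘(ℝ, E) p →L[ℝ] ℝ) p (η α p))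
  φ_φ (α β : Fin 3) (p : M) (v : TangentSpace 𝓘(ℝ, E) p) :
    φ α p (φ β p v) =
      -((if α = β then (1 : ℝ) else 0) • v) + η β p v • ξ α p
        + ∑ γ, leviCivita α β γ • φ γ p v
  φ_ξ (α β : Fin 3) (p : M) : φ α p (ξ β p) = ∑ γ, leviCivita α β γ • ξ γ p
  η_φ (α β : Fin 3) (p : M) (v : TangentSpace 𝓘(ℝ, E) p) :
    η α p (φ β p v) = ∑ γ, leviCivita α β γ * η γ p v
  η_ξ (α β : Fin 3) (p : M) : η α p (ξ β p) = if α = β then 1 else 0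

/-- An almost contact HN-metric 3-structure: an almost contact 3-structure with a
pseudo-Riemannian metric `g` such that
`g(φ_α x, φ_α y) = ε_α g(x, y) + η_α(x) η_α(y)` for `α = 1, 2, 3`. -/
structure AlmostContactHNMetric3Structure extends AlmostContact3Structure E M where
  /-- the HN-metric -/
  g : PseudoRiemannianMetric E M
  g_φ_φ (α : Fin 3) (p : M) (v w : TangentSpace 𝓘(ℝ, E) p) :
    g.form p (φ α p v) (φ α p w) = hnSign α * g.form p v w + η α p v * η α p w

namespace AlmostContactHNMetric3Structure

variable {E M} (S : AlmostContactHNMetric3Structure E M)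

/-- The vector field `φ_α x`. -/
def phi (α : Fin 3) (X : Π p : M, TangentSpace 𝓘(ℝ, E) p) (p : M) : TangentSpace 𝓘(ℝ, E) p :=
  S.φ α p (X p)

/-- `{φ_α, φ_α}(x, y) = {φ_α x, φ_α y} + φ_α²{x, y} - φ_α{φ_α x, y} - φ_α{x, φ_α y}`. -/
def phiBraces (α : Fin 3) (X Y : Π p : M, TangentSpace 𝓘(ℝ, E) p) :
    Π p : M, TangentSpace 𝓘(ℝ, E) p :=
  S.g.braces (S.phi α X) (S.phi α Y)
    + S.phi α (S.phi α (S.g.braces X Y))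
    - S.phi α (S.g.braces (S.phi α X) Y)
    - S.phi α (S.g.braces X (S.phi α Y))

/-- The associated Nijenhuis tensor
`N̂_α(x, y) = {φ_α, φ_α}(x, y) - ε_α (𝔏_{ξ_α} g)(x, y) ξ_α`, evaluated on vector fields. -/
def assocNijenhuis (α : Fin 3) (X Y : Π p : M, TangentSpace 𝓘(ℝ, E) p) (p : M) :
    TangentSpace 𝓘(ℝ, E) p :=
  S.phiBraces α X Y p - (hnSign α * S.g.lieDeriv (S.ξ α) X Y p) • S.ξ α p

/-- The tensor `N̂_α` vanishes: `N̂_α(x, y) = 0` for all smooth vector fields `x`, `y`. -/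
def AssocNijenhuisVanishes (α : Fin 3) : Prop :=
  ∀ X Y : Π p : M, TangentSpace 𝓘(ℝ, E) p, SmoothField X → SmoothField Y →
    ∀ p : M, S.assocNijenhuis α X Y p = 0

end AlmostContactHNMetric3Structure

end Structure

end HNContact

end

/-!
Write `J_α (x + f ∂/∂t) = φ_α x - f ξ_α + η_α(x) ∂/∂t` for the endomorphisms of the tangent bundle
of `M × ℝ` induced by the almost contact 3-structure. They satisfy the quaternion relations
`J_α J_β = -δ_{αβ} + ∑ ε_{αβγ} J_γ`, and the symmetric braces of the product metric on `M × ℝ` turn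
`N̂_α(x, y)` into the `M`-component of the concomitant `N_α(x, y)` of `J_α`.

The concomitant is symmetric and satisfies `N_α(J_α x, y) = -J_α N_α(x, y)`, and every field on
`M × ℝ` is the sum of a field on `M` and the `J_α`-image of a multiple of `ξ_α`, so `N_α` vanishes
if `N_α(x, y) = 0` for all fields `x`, `y` on `M`. If `N̂_α = 0`, then these `N_α(x, y)` are
multiples of `∂/∂t`, and do not change when `x` and `y` are replaced by `η_α(x) ξ_α` and
`η_α(y) ξ_α`, for which the `∂/∂t`-component is zero. Hence `N̂_α = 0` is equivalent to `N_α = 0`.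

For anticommuting `I` and `J` with vanishing concomitants, the concomitant of `IJ` has an expression
which is antisymmetric in `(I, J)`, whereas `IJ` and `JI = -IJ` have the same concomitant; hence it
vanishes.
-/

noncomputable section

namespace HNContact

section Nijenhuis

variable {V A : Type*} [AddCommGroup V] [AddCommGroup A]

/-- The Nijenhuis concomitant of a biadditive operation `B` and an almost complex structure, which
acts as `J` on the arguments and as `j` on the values of `B`. The usual term `j² B(x, y)` is written
as `-B(x, y)`. -/
def nijenhuis (B : V →+ V →+ A) (J : AddMonoid.End V) (j : AddMonoid.End A) : V →+ V →+ A :=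
  (B.comp J).compl₂ J - B - (B.comp J).compr₂ j - (B.compl₂ J).compr₂ j

variable {B : V →+ V →+ A} {I J : AddMonoid.End V} {i j : AddMonoid.End A}

lemma nijenhuis_apply (x y : V) :
    nijenhuis B J j x y = B (J x) (J y) - B x y - j (B (J x) y) - j (B x (J y)) := rfl

lemma nijenhuis_comm (hB : ∀ x y, B x y = B y x) (x y : V) :
    nijenhuis B J j x y = nijenhuis B J j y x := by
  simp only [nijenhuis_apply, hB x, hB (J x)]
  abel

lemma nijenhuis_neg : nijenhuis B (-J) (-j) = nijenhuis B J j := by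
  have hJ (x) : (-J) x = -J x := rfl
  have hj (a) : (-j) a = -j a := rfl
  ext x y
  simp only [nijenhuis_apply, hJ, hj, map_neg, AddMonoidHom.neg_apply, neg_neg]

section SqEqNegOne

variable (hJ : J * J = -1) (hj : j * j = -1)
include hJ hj

lemma nijenhuis_apply_left (x y : V) : nijenhuis B J j (J x) y = -j (nijenhuis B J j x y) := by
  have hJ' (x) : J (J x) = -x := DFunLike.congr_fun hJ x
  have hj' (a) : j (j a) = -a := DFunLike.congr_fun hj a
  simp only [nijenhuis_apply, hJ', hj', map_sub, map_neg, AddMonoidHom.neg_apply]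
  abel

end SqEqNegOne

section Anticommute

variable (hIJ : J * I = -(I * J)) (hI : nijenhuis B I i = 0) (hJ : nijenhuis B J j = 0)
include hIJ hI hJ

lemma nijenhuis_mul_apply (x y : V) :
    nijenhuis B (I * J) (i * j) x y =
      j (B (J x) y + B x (J y)) - i (B (I x) y + B x (I y))
        - i (j (B (I x) (J y) + B (J x) (I y))) := by
  have hJI (x) : J (I x) = -I (J x) := DFunLike.congr_fun hIJ x
  have hNI (x y) : nijenhuis B I i x y = 0 := by rw [hI]; rfl
  have hNJ (x y) : nijenhuis B J j x y = 0 := by rw [hJ]; rfl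
  have h₁ := hNI (J x) (J y)
  have h₂ := hNJ x y
  have h₃ := congrArg i (hNJ (I x) y)
  have h₄ := congrArg i (hNJ x (I y))
  simp only [nijenhuis_apply, hJI, map_sub, map_add, map_neg, map_zero, AddMonoidHom.neg_apply,
    AddMonoid.End.coe_mul, Function.comp_apply] at h₁ h₂ h₃ h₄ ⊢
  linear_combination (norm := abel) h₁ + h₂ - h₃ - h₄

theorem nijenhuis_mul_eq_zero [IsAddTorsionFree A] (hij : j * i = -(i * j)) :
    nijenhuis B (I * J) (i * j) = 0 := by
  have hJI : I * J = -(J * I) := by rw [hIJ, neg_neg]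
  have hji (a) : j (i a) = -i (j a) := DFunLike.congr_fun hij a
  ext x y
  have hswap : nijenhuis B (I * J) (i * j) x y = nijenhuis B (J * I) (j * i) x y := by
    rw [hIJ, hij, nijenhuis_neg]
  refine self_eq_neg.1 (hswap.trans ?_)
  rw [nijenhuis_mul_apply hJI hJ hI, nijenhuis_mul_apply hIJ hI hJ, hji,
    add_comm (B (J x) (I y))]
  abel

end Anticommute

end Nijenhuis

section LeviCivita

lemma leviCivita_self (α γ : Fin 3) : leviCivita α α γ = 0 := by
  fin_cases α <;> fin_cases γ <;> rfl

lemma leviCivita_swap (α β γ : Fin 3) : leviCivita β α γ = -leviCivita α β γ := by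
  fin_cases α <;> fin_cases β <;> fin_cases γ <;> simp [leviCivita]

lemma leviCivita_of_eq_one {α β γ : Fin 3} (h : leviCivita α β γ = 1) (δ : Fin 3) :
    leviCivita α β δ = if δ = γ then 1 else 0 := by
  revert h
  fin_cases α <;> fin_cases β <;> fin_cases γ <;> fin_cases δ <;> simp [leviCivita]

lemma leviCivita_eq_one_or_swap_eq_one {α β γ : Fin 3} (hαβ : α ≠ β) (hαγ : α ≠ γ) (hβγ : β ≠ γ) :
    leviCivita α β γ = 1 ∨ leviCivita β α γ = 1 := by
  revert hαβ hαγ hβγ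
  fin_cases α <;> fin_cases β <;> fin_cases γ <;> simp [leviCivita]

end LeviCivita

variable {E : Type*} [NormedAddCommGroup E] [NormedSpace ℝ E]
  {M : Type*} [TopologicalSpace M] [ChartedSpace E M]

section DirDeriv

variable {X Y : Π p : M, TangentSpace 𝓘(ℝ, E) p} {f h : M → ℝ} {p : M}

lemma dirDeriv_zero : dirDeriv X 0 p = 0 := by
  simp [dirDeriv]

lemma dirDeriv_add (hf : MDifferentiableAt 𝓘(ℝ, E) 𝓘(ℝ) f p)
    (hh : MDifferentiableAt 𝓘(ℝ, E) 𝓘(ℝ) h p) :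
    dirDeriv X (f + h) p = dirDeriv X f p + dirDeriv X h p := by
  simp [dirDeriv, mvfderiv_add hf hh]

lemma dirDeriv_const_smul (c : ℝ) (hf : MDifferentiableAt 𝓘(ℝ, E) 𝓘(ℝ) f p) :
    dirDeriv X (c • f) p = c * dirDeriv X f p := by
  have h := mvfderiv_mul (f := fun _ ↦ c) mdifferentiableAt_const hf
  rw [mvfderiv_const, smul_zero, add_zero] at h
  exact DFunLike.congr_fun h (X p)

lemma dirDeriv_add_left : dirDeriv (X + Y) f p = dirDeriv X f p + dirDeriv Y f p := by
  simp [dirDeriv]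

lemma dirDeriv_zero_left : dirDeriv (0 : Π p : M, TangentSpace 𝓘(ℝ, E) p) f p = 0 := by
  simp [dirDeriv]

end DirDeriv

variable [IsManifold 𝓘(ℝ, E) ∞ M]

lemma SmoothField.diffFieldAt {X : Π p : M, TangentSpace 𝓘(ℝ, E) p} (hX : SmoothField X) (p : M) :
    DiffFieldAt X p :=
  hX.mdifferentiableAt (by simp)

variable (E M) in
/-- The smooth vector fields on `M`, bundled so that they form an additive group. -/
abbrev SmoothVectorField : Type _ :=
  Cₛ^∞⟮𝓘(ℝ, E); E, (TangentSpace 𝓘(ℝ, E) : M → Type _)⟯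

lemma SmoothVectorField.diffFieldAt (X : SmoothVectorField E M) (p : M) : DiffFieldAt X p :=
  SmoothField.diffFieldAt X.contMDiff p

lemma diffFieldAt_zero (p : M) : DiffFieldAt (0 : Π p : M, TangentSpace 𝓘(ℝ, E) p) p :=
  SmoothVectorField.diffFieldAt 0 p

namespace PseudoRiemannianMetric

variable {g : PseudoRiemannianMetric E M} {X X' Y Z : Π p : M, TangentSpace 𝓘(ℝ, E) p} {p : M}

lemma pair_comm (X Y : Π p : M, TangentSpace 𝓘(ℝ, E) p) : g.pair X Y = g.pair Y X :=
  funext fun p ↦ g.symm p (X p) (Y p)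

lemma pair_add_left : g.pair (X + X') Y = g.pair X Y + g.pair X' Y := by
  ext q
  simp [pair]

lemma pair_add_right : g.pair Y (X + X') = g.pair Y X + g.pair Y X' := by
  rw [pair_comm, pair_add_left, pair_comm X, pair_comm X']

lemma pair_mlieBracket_swap :
    g.pair (VectorField.mlieBracket 𝓘(ℝ, E) X Y) Z p =
      -g.pair (VectorField.mlieBracket 𝓘(ℝ, E) Y X) Z p := by
  simp [pair, VectorField.mlieBracket_swap_apply (V := X)]

lemma symKoszul_comm : g.symKoszul X Y Z p = g.symKoszul Y X Z p := by
  rw [symKoszul, symKoszul, pair_comm X Y, pair_mlieBracket_swap (X := Y) (Y := Z),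
    pair_mlieBracket_swap (X := Z) (Y := X)]
  ring

lemma lieDeriv_eq_sub_symKoszul :
    g.lieDeriv Z X Y p =
      dirDeriv X (g.pair Y Z) p + dirDeriv Y (g.pair X Z) p - g.symKoszul X Y Z p := by
  rw [lieDeriv, symKoszul, pair_comm X (VectorField.mlieBracket 𝓘(ℝ, E) Z Y),
    pair_mlieBracket_swap (X := Y)]
  ring

lemma symKoszul_add_left [CompleteSpace E] (hX : DiffFieldAt X p) (hX' : DiffFieldAt X' p)
    (hY : DiffFieldAt Y p) (hZ : DiffFieldAt Z p) :
    g.symKoszul (X + X') Y Z p = g.symKoszul X Y Z p + g.symKoszul X' Y Z p := by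
  have hbracket : g.pair (VectorField.mlieBracket 𝓘(ℝ, E) Z (X + X')) Y p =
      g.pair (VectorField.mlieBracket 𝓘(ℝ, E) Z X) Y p
        + g.pair (VectorField.mlieBracket 𝓘(ℝ, E) Z X') Y p := by
    simp [pair, VectorField.mlieBracket_add_right hX hX']
  simp only [symKoszul, pair_add_left, pair_add_right, Pi.add_apply, hbracket, dirDeriv_add_left,
    dirDeriv_add (mdifferentiableAt_pair hX hZ) (mdifferentiableAt_pair hX' hZ),
    dirDeriv_add (mdifferentiableAt_pair hX hY) (mdifferentiableAt_pair hX' hY)]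
  ring

variable [FiniteDimensional ℝ E]

lemma braces_comm (hX : DiffFieldAt X p) (hY : DiffFieldAt Y p) :
    g.braces X Y p = g.braces Y X p :=
  eq_braces hY hX _ fun Z hZ ↦ by rw [form_braces hX hY hZ, symKoszul_comm]

lemma braces_add_left (hX : DiffFieldAt X p) (hX' : DiffFieldAt X' p) (hY : DiffFieldAt Y p) :
    g.braces (X + X') Y p = g.braces X Y p + g.braces X' Y p := by
  have : CompleteSpace E := FiniteDimensional.complete ℝ E
  refine (eq_braces (mdifferentiableAt_add_section hX hX') hY _ fun Z hZ ↦ ?_).symm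
  rw [map_add, add_apply, form_braces hX hY hZ, form_braces hX' hY hZ,
    symKoszul_add_left hX hX' hY hZ]

lemma braces_add_right (hX : DiffFieldAt X p) (hX' : DiffFieldAt X' p) (hY : DiffFieldAt Y p) :
    g.braces Y (X + X') p = g.braces Y X p + g.braces Y X' p := by
  rw [braces_comm hY (mdifferentiableAt_add_section hX hX'), braces_add_left hX hX' hY,
    braces_comm hX hY, braces_comm hX' hY]

lemma braces_zero_left (hY : DiffFieldAt Y p) : g.braces 0 Y p = 0 := by
  simpa using braces_add_left (g := g) (diffFieldAt_zero p) (diffFieldAt_zero p) hY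

lemma braces_zero_right (hX : DiffFieldAt X p) : g.braces X 0 p = 0 := by
  rw [braces_comm hX (diffFieldAt_zero p), braces_zero_left hX]

lemma lieDeriv_eq_sub_form_braces (hX : DiffFieldAt X p) (hY : DiffFieldAt Y p)
    (hZ : DiffFieldAt Z p) :
    g.lieDeriv Z X Y p =
      dirDeriv X (g.pair Y Z) p + dirDeriv Y (g.pair X Z) p - g.form p (g.braces X Y p) (Z p) := by
  rw [lieDeriv_eq_sub_symKoszul, form_braces hX hY hZ]

end PseudoRiemannianMetric

section Cylinder

variable (E M) in
/-- The smooth vector fields `x + f ∂/∂t` on `M × ℝ` with `x` and `f` independent of `t`, written as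
pairs `(x, f)`. -/
abbrev CylinderField : Type _ :=
  SmoothVectorField E M × C^∞⟮𝓘(ℝ, E), M; ℝ⟯

namespace CylinderField

lemma mdifferentiableAt_snd (x : CylinderField E M) (p : M) :
    MDifferentiableAt 𝓘(ℝ, E) 𝓘(ℝ) x.2 p :=
  x.2.contMDiff.mdifferentiableAt (by simp)

lemma ext {x y : CylinderField E M} (h : ∀ p, (x.1 p, x.2 p) = (y.1 p, y.2 p)) : x = y :=
  Prod.ext (ContMDiffSection.ext fun p ↦ congrArg Prod.fst (h p))
    (ContMDiffMap.ext fun p ↦ congrArg Prod.snd (h p))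

end CylinderField

variable [FiniteDimensional ℝ E]

/-- The symmetric braces, at the points over `p`, of the product metric of `g` and `dt²` on
`M × ℝ`. -/
def cylinderBraces (g : PseudoRiemannianMetric E M) (p : M) :
    CylinderField E M →+ CylinderField E M →+ TangentSpace 𝓘(ℝ, E) p × ℝ :=
  AddMonoidHom.mk'
    (fun x ↦ AddMonoidHom.mk'
      (fun y ↦ (g.braces x.1 y.1 p, dirDeriv x.1 y.2 p + dirDeriv y.1 x.2 p))
      fun y y' ↦ Prod.ext
        (PseudoRiemannianMetric.braces_add_right (y.1.diffFieldAt p) (y'.1.diffFieldAt p)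
          (x.1.diffFieldAt p))
        ((congrArg₂ (· + ·)
          (dirDeriv_add (y.mdifferentiableAt_snd p) (y'.mdifferentiableAt_snd p))
          dirDeriv_add_left).trans (add_add_add_comm ..)))
    fun x x' ↦ AddMonoidHom.ext fun y ↦ Prod.ext
      (PseudoRiemannianMetric.braces_add_left (x.1.diffFieldAt p) (x'.1.diffFieldAt p)
        (y.1.diffFieldAt p))
      ((congrArg₂ (· + ·) dirDeriv_add_left
        (dirDeriv_add (x.mdifferentiableAt_snd p) (x'.mdifferentiableAt_snd p))).trans
          (add_add_add_comm ..))

lemma cylinderBraces_apply (g : PseudoRiemannianMetric E M) (p : M) (x y : CylinderField E M) :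
    cylinderBraces g p x y = (g.braces x.1 y.1 p, dirDeriv x.1 y.2 p + dirDeriv y.1 x.2 p) := rfl

lemma cylinderBraces_comm (g : PseudoRiemannianMetric E M) (p : M) (x y : CylinderField E M) :
    cylinderBraces g p x y = cylinderBraces g p y x := by
  rw [cylinderBraces_apply, cylinderBraces_apply, add_comm,
    PseudoRiemannianMetric.braces_comm (x.1.diffFieldAt p) (y.1.diffFieldAt p)]

end Cylinder

namespace AlmostContactHNMetric3Structure

variable {S : AlmostContactHNMetric3Structure E M} {α β γ : Fin 3} {p : M}
  {X Y : Π p : M, TangentSpace 𝓘(ℝ, E) p}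

lemma φ_ξ_self : S.φ α p (S.ξ α p) = 0 := by
  simp [S.φ_ξ, leviCivita_self]

lemma η_ξ_self : S.η α p (S.ξ α p) = 1 := by
  simp [S.η_ξ]

lemma φ_φ_self (v : TangentSpace 𝓘(ℝ, E) p) :
    S.φ α p (S.φ α p v) = -v + S.η α p v • S.ξ α p := by
  simp [S.φ_φ, leviCivita_self]

lemma η_eq_form_ξ (v : TangentSpace 𝓘(ℝ, E) p) :
    S.η α p v = -hnSign α * S.g.form p v (S.ξ α p) := by
  have h := S.g_φ_φ α p v (S.ξ α p)
  rw [φ_ξ_self, map_zero, η_ξ_self] at h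
  linear_combination -h

variable (S) in
/-- The function `η_α(x)`. -/
def eta (α : Fin 3) (X : Π p : M, TangentSpace 𝓘(ℝ, E) p) (p : M) : ℝ := S.η α p (X p)

lemma eta_eq_smul_pair_ξ : S.eta α X = -hnSign α • S.g.pair X (S.ξ α) :=
  funext fun p ↦ η_eq_form_ξ (X p)

lemma smoothField_phi (hX : SmoothField X) : SmoothField (S.phi α X) :=
  ContMDiff.clm_bundle_apply (F₁ := E) (F₂ := E) (S.contMDiff_φ α) hX

lemma contMDiff_eta (hX : SmoothField X) : ContMDiff 𝓘(ℝ, E) 𝓘(ℝ) ∞ (S.eta α X) := by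
  have h : ContMDiff 𝓘(ℝ, E) (𝓘(ℝ, E).prod 𝓘(ℝ)) ∞
      (fun m ↦ Bundle.TotalSpace.mk' ℝ (E := Bundle.Trivial M ℝ) m (S.η α m (X m))) :=
    ContMDiff.clm_bundle_apply (F₁ := E) (F₂ := ℝ) (S.contMDiff_η α) hX
  exact fun p ↦ (Bundle.contMDiffAt_totalSpace.1 (h p)).2

section CylinderJ

variable (S) in
/-- The value over `p` of the almost complex structure
`x + f ∂/∂t ↦ φ_α x - f ξ_α + η_α(x) ∂/∂t` on `M × ℝ`. -/
def cylinderJAt (α : Fin 3) (p : M) : AddMonoid.End (TangentSpace 𝓘(ℝ, E) p × ℝ) :=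
  AddMonoidHom.mk' (fun v ↦ (S.φ α p v.1 - v.2 • S.ξ α p, S.η α p v.1)) fun v w ↦ by
    ext
    · simp only [Prod.fst_add, Prod.snd_add, map_add, add_smul, add_sub_add_comm]
    · simp only [Prod.fst_add, Prod.snd_add, map_add]

lemma cylinderJAt_apply (v : TangentSpace 𝓘(ℝ, E) p × ℝ) :
    S.cylinderJAt α p v = (S.φ α p v.1 - v.2 • S.ξ α p, S.η α p v.1) := rfl

variable (S) in
/-- The action of the almost complex structure `cylinderJAt` on vector fields. -/
def cylinderJ (α : Fin 3) : AddMonoid.End (CylinderField E M) :=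
  AddMonoidHom.mk'
    (fun x ↦
      (⟨S.phi α x.1 - (x.2 : M → ℝ) • S.ξ α,
        (smoothField_phi x.1.contMDiff).sub_section (x.2.contMDiff.smul_section (S.smooth_ξ α))⟩,
      ⟨S.eta α x.1, contMDiff_eta x.1.contMDiff⟩))
    fun x y ↦ Prod.ext
      (ContMDiffSection.ext fun p ↦
        congrArg Prod.fst (map_add (S.cylinderJAt α p) (x.1 p, x.2 p) (y.1 p, y.2 p)))
      (ContMDiffMap.ext fun p ↦ map_add (S.η α p) (x.1 p) (y.1 p))

lemma cylinderJAt_cylinderJAt (v : TangentSpace 𝓘(ℝ, E) p × ℝ) :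
    S.cylinderJAt α p (S.cylinderJAt β p v) =
      -((if α = β then (1 : ℝ) else 0) • v) + ∑ γ, leviCivita α β γ • S.cylinderJAt γ p v := by
  ext
  · simp only [cylinderJAt_apply, map_sub, map_smul, S.φ_φ, S.φ_ξ, Prod.fst_add, Prod.fst_neg,
      Prod.smul_fst, Prod.fst_sum, smul_sub, Finset.sum_sub_distrib, Finset.smul_sum,
      smul_comm v.2]
    abel
  · simp only [cylinderJAt_apply, map_sub, map_smul, S.η_φ, S.η_ξ, Prod.snd_add, Prod.snd_neg,
      Prod.smul_snd, Prod.snd_sum, smul_eq_mul]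
    ring

lemma cylinderJAt_mul_self : S.cylinderJAt α p * S.cylinderJAt α p = -1 := by
  ext1 v
  change S.cylinderJAt α p (S.cylinderJAt α p v) = -v
  simp [cylinderJAt_cylinderJAt, leviCivita_self]

lemma cylinderJAt_mul (h : leviCivita α β γ = 1) :
    S.cylinderJAt α p * S.cylinderJAt β p = S.cylinderJAt γ p := by
  have hne : α ≠ β := by
    rintro rfl
    simp [leviCivita_self] at h
  ext1 v
  change S.cylinderJAt α p (S.cylinderJAt β p v) = _
  simp [cylinderJAt_cylinderJAt, leviCivita_of_eq_one h, hne]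

lemma cylinderJAt_mul_swap (h : leviCivita α β γ = 1) :
    S.cylinderJAt β p * S.cylinderJAt α p = -S.cylinderJAt γ p := by
  have hne : β ≠ α := by
    rintro rfl
    simp [leviCivita_self] at h
  ext1 v
  change S.cylinderJAt β p (S.cylinderJAt α p v) = -S.cylinderJAt γ p v
  simp [cylinderJAt_cylinderJAt, leviCivita_swap α β, leviCivita_of_eq_one h, hne]

lemma cylinderJ_mul_self : S.cylinderJ α * S.cylinderJ α = -1 :=
  AddMonoidHom.ext fun x ↦ CylinderField.ext fun p ↦
    DFunLike.congr_fun cylinderJAt_mul_self (x.1 p, x.2 p)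

lemma cylinderJ_mul (h : leviCivita α β γ = 1) :
    S.cylinderJ α * S.cylinderJ β = S.cylinderJ γ :=
  AddMonoidHom.ext fun x ↦ CylinderField.ext fun p ↦
    DFunLike.congr_fun (cylinderJAt_mul h) (x.1 p, x.2 p)

lemma cylinderJ_mul_swap (h : leviCivita α β γ = 1) :
    S.cylinderJ β * S.cylinderJ α = -S.cylinderJ γ :=
  AddMonoidHom.ext fun x ↦ CylinderField.ext fun p ↦
    DFunLike.congr_fun (cylinderJAt_mul_swap h) (x.1 p, x.2 p)

variable (S) in
/-- The vector field `f ξ_α` on `M`. -/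
def smulReeb (α : Fin 3) (f : C^∞⟮𝓘(ℝ, E), M; ℝ⟯) : SmoothVectorField E M :=
  ⟨(f : M → ℝ) • S.ξ α, f.contMDiff.smul_section (S.smooth_ξ α)⟩

lemma cylinderJ_smulReeb (f : C^∞⟮𝓘(ℝ, E), M; ℝ⟯) :
    S.cylinderJ α (S.smulReeb α f, 0) = (0, f) :=
  CylinderField.ext fun p ↦ by
    change (S.φ α p (f p • S.ξ α p) - (0 : ℝ) • S.ξ α p, S.η α p (f p • S.ξ α p)) = (0, f p)
    simp [φ_ξ_self, η_ξ_self]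

variable (S α) in
lemma fst_add_cylinderJ_smulReeb_snd (x : CylinderField E M) :
    (x.1, 0) + S.cylinderJ α (S.smulReeb α x.2, 0) = x := by
  simp [cylinderJ_smulReeb]

end CylinderJ

lemma hnSign_mul_lieDeriv_ξ [FiniteDimensional ℝ E] (hX : DiffFieldAt X p)
    (hY : DiffFieldAt Y p) :
    hnSign α * S.g.lieDeriv (S.ξ α) X Y p =
      S.η α p (S.g.braces X Y p) - dirDeriv X (S.eta α Y) p - dirDeriv Y (S.eta α X) p := by
  have hξ : DiffFieldAt (S.ξ α) p := (S.smooth_ξ α).diffFieldAt p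
  rw [PseudoRiemannianMetric.lieDeriv_eq_sub_form_braces hX hY hξ, η_eq_form_ξ, eta_eq_smul_pair_ξ,
    eta_eq_smul_pair_ξ, dirDeriv_const_smul _ (PseudoRiemannianMetric.mdifferentiableAt_pair hX hξ),
    dirDeriv_const_smul _ (PseudoRiemannianMetric.mdifferentiableAt_pair hY hξ)]
  ring

section CylinderNijenhuis

variable [FiniteDimensional ℝ E] {X Y : SmoothVectorField E M}

variable (S) in
/-- The Nijenhuis concomitant, at the points over `p`, of the almost complex structure `cylinderJ`
and the symmetric braces of `M × ℝ`. -/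
def cylinderNijenhuis (α : Fin 3) (p : M) :
    CylinderField E M →+ CylinderField E M →+ TangentSpace 𝓘(ℝ, E) p × ℝ :=
  nijenhuis (cylinderBraces S.g p) (S.cylinderJ α) (S.cylinderJAt α p)

lemma cylinderNijenhuis_comm (x y : CylinderField E M) :
    S.cylinderNijenhuis α p x y = S.cylinderNijenhuis α p y x :=
  nijenhuis_comm (cylinderBraces_comm S.g p) x y

lemma cylinderNijenhuis_cylinderJ_left (x y : CylinderField E M) :
    S.cylinderNijenhuis α p (S.cylinderJ α x) y =
      -S.cylinderJAt α p (S.cylinderNijenhuis α p x y) :=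
  nijenhuis_apply_left cylinderJ_mul_self cylinderJAt_mul_self x y

lemma fst_cylinderNijenhuis :
    (S.cylinderNijenhuis α p (X, 0) (Y, 0)).1 = S.assocNijenhuis α X Y p := by
  have hJ (Z : SmoothVectorField E M) :
      ((S.cylinderJ α (Z, 0)).1 : Π p, TangentSpace 𝓘(ℝ, E) p) = S.phi α Z := by
    ext q
    change S.phi α Z q - (0 : ℝ) • S.ξ α q = S.phi α Z q
    rw [zero_smul, sub_zero]
  have hη (Z : SmoothVectorField E M) :
      ((S.cylinderJ α (Z, 0)).2 : M → ℝ) = S.eta α Z := rfl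
  simp only [assocNijenhuis, phiBraces, phi, Pi.add_apply, Pi.sub_apply, φ_φ_self,
    hnSign_mul_lieDeriv_ξ (X.diffFieldAt p) (Y.diffFieldAt p), cylinderNijenhuis, nijenhuis_apply,
    cylinderBraces_apply, cylinderJAt_apply, hJ, hη, ContMDiffMap.coe_zero, dirDeriv_zero,
    Prod.fst_sub]
  module

lemma snd_cylinderNijenhuis_smulReeb (a b : C^∞⟮𝓘(ℝ, E), M; ℝ⟯) :
    (S.cylinderNijenhuis α p (S.smulReeb α a, 0) (S.smulReeb α b, 0)).2 = 0 := by
  simp [cylinderNijenhuis, nijenhuis_apply, cylinderJ_smulReeb, cylinderBraces_apply,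
    cylinderJAt_apply, dirDeriv_zero, dirDeriv_zero_left,
    PseudoRiemannianMetric.braces_zero_left (SmoothVectorField.diffFieldAt _ p),
    PseudoRiemannianMetric.braces_zero_right (SmoothVectorField.diffFieldAt _ p)]

lemma snd_cylinderNijenhuis_eq_smulReeb (h : S.AssocNijenhuisVanishes α) :
    (S.cylinderNijenhuis α p (X, 0) (Y, 0)).2 =
      (S.cylinderNijenhuis α p (S.smulReeb α (S.cylinderJ α (X, 0)).2, 0) (Y, 0)).2 := by
  have hfst (Z : SmoothVectorField E M) :
      (S.cylinderNijenhuis α p (Z, 0) (Y, 0)).1 = 0 :=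
    fst_cylinderNijenhuis.trans (h Z Y Z.contMDiff Y.contMDiff p)
  have hN := cylinderNijenhuis_cylinderJ_left (S := S) (α := α) (p := p) (X, 0) (Y, 0)
  rw [← fst_add_cylinderJ_smulReeb_snd S α (S.cylinderJ α (X, 0)), map_add,
    AddMonoidHom.add_apply, cylinderNijenhuis_cylinderJ_left] at hN
  have hξ := congrArg (fun v ↦ S.η α p v.1) hN
  simpa [cylinderJAt_apply, hfst, η_ξ_self] using hξ.symm

lemma cylinderNijenhuis_eq_zero_of_fst {y : CylinderField E M}
    (hy : ∀ X, S.cylinderNijenhuis α p (X, 0) y = 0) (x : CylinderField E M) :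
    S.cylinderNijenhuis α p x y = 0 := by
  rw [← fst_add_cylinderJ_smulReeb_snd S α x, map_add, AddMonoidHom.add_apply,
    cylinderNijenhuis_cylinderJ_left, hy, hy, map_zero, neg_zero, add_zero]

lemma assocNijenhuisVanishes_iff :
    S.AssocNijenhuisVanishes α ↔ ∀ p, S.cylinderNijenhuis α p = 0 := by
  constructor
  · intro h p
    have hM (X Y) : S.cylinderNijenhuis α p (X, 0) (Y, 0) = 0 := by
      refine Prod.ext (fst_cylinderNijenhuis.trans (h X Y X.contMDiff Y.contMDiff p)) ?_
      rw [snd_cylinderNijenhuis_eq_smulReeb h, cylinderNijenhuis_comm,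
        snd_cylinderNijenhuis_eq_smulReeb h, snd_cylinderNijenhuis_smulReeb]
      rfl
    have hM' (X y) : S.cylinderNijenhuis α p (X, 0) y = 0 := by
      rw [cylinderNijenhuis_comm]
      exact cylinderNijenhuis_eq_zero_of_fst (hM · X) y
    ext1 x
    ext1 y
    exact cylinderNijenhuis_eq_zero_of_fst (hM' · y) x
  · intro h X Y hX hY p
    have hfst := fst_cylinderNijenhuis (S := S) (α := α) (p := p) (X := ⟨X, hX⟩) (Y := ⟨Y, hY⟩)
    rw [h] at hfst
    exact hfst.symm

end CylinderNijenhuis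

theorem AssocNijenhuisVanishes.of_leviCivita_eq_one [FiniteDimensional ℝ E]
    (h : leviCivita α β γ = 1) (hα : S.AssocNijenhuisVanishes α)
    (hβ : S.AssocNijenhuisVanishes β) : S.AssocNijenhuisVanishes γ := by
  rw [assocNijenhuisVanishes_iff] at hα hβ ⊢
  intro p
  have : IsAddTorsionFree (TangentSpace 𝓘(ℝ, E) p × ℝ) := .of_isTorsionFree ℝ _
  have hJ : S.cylinderJ β * S.cylinderJ α = -(S.cylinderJ α * S.cylinderJ β) := by
    rw [cylinderJ_mul_swap h, cylinderJ_mul h]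
  have hj : S.cylinderJAt β p * S.cylinderJAt α p = -(S.cylinderJAt α p * S.cylinderJAt β p) := by
    rw [cylinderJAt_mul_swap h, cylinderJAt_mul h]
  rw [cylinderNijenhuis, ← cylinderJ_mul h, ← cylinderJAt_mul h]
  exact nijenhuis_mul_eq_zero hJ (hα p) (hβ p) hj

end AlmostContactHNMetric3Structure

end HNContact

end

theorem theorem7_general {E : Type*} [NormedAddCommGroup E] [NormedSpace ℝ E]
    [FiniteDimensional ℝ E] {M : Type*} [TopologicalSpace M] [ChartedSpace E M]
    [IsManifold 𝓘(ℝ, E) ∞ M] (S : HNContact.AlmostContactHNMetric3Structure E M)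
    {α β γ : Fin 3} (hαβ : α ≠ β) (hαγ : α ≠ γ) (hβγ : β ≠ γ)
    (hα : S.AssocNijenhuisVanishes α) (hβ : S.AssocNijenhuisVanishes β) :
    S.AssocNijenhuisVanishes γ := by
  obtain h | h := HNContact.leviCivita_eq_one_or_swap_eq_one hαβ hαγ hβγ
  · exact .of_leviCivita_eq_one h hα hβ
  · exact .of_leviCivita_eq_one h hβ hα

theorem theorem7 (n : ℕ) {M : Type*} [TopologicalSpace M] [T2Space M]
    [ChartedSpace (EuclideanSpace ℝ (Fin (4 * n + 3))) M]
    [IsManifold (𝓡 (4 * n + 3)) ∞ M]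
    (S : HNContact.AlmostContactHNMetric3Structure (EuclideanSpace ℝ (Fin (4 * n + 3))) M)
    (α β γ : Fin 3) (hαβ : α ≠ β) (hαγ : α ≠ γ) (hβγ : β ≠ γ)
    (hα : S.AssocNijenhuisVanishes α) (hβ : S.AssocNijenhuisVanishes β) :
    S.AssocNijenhuisVanishes γ := by
  exact theorem7_general S hαβ hαγ hβγ hα hβ
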